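/- **Setting.** A lattice $L$ is a free abelian group of finite rank with a $\mathbb{Q}$-valued symmetric bilinear form $(v,w)\mapsto v\cdot w$, extended to $V=L\otimes\mathbb{R}$; write $v^2=v\cdot v$, the norm of $v$. $L$ is Euclidean if the form is positive definite, and Lorentzian if it has signature $(n,1)$ with $n\ge 1$. A vector $\alpha\in L$ with $\alpha^2>0$ and $\alpha\cdot L\subseteq\frac{\alpha^2}{2}\mathbb{Z}$ is an almost-root of $L$; it is a root of $L$ if moreover it is primitive ($L/\langle\alpha\rangle$ is torsion-free). The reflection in $\alpha$ is $x\mapsto x-\frac{2(x\cdot\alpha)}{\alpha^2}\alpha$. If $W$ is a subgroup of the isometry group $\mathrm{O}(L)$ generated by reflections in roots of $L$, the (almost-)roots of $W$ are the (almost-)roots of $L$ whose reflections lie in $W$, and the mirrors of $W$ are the hyperplanes $\alpha^\perp$, $\alpha$ a root of $W$. A chamber $C$ of $W$ (viewed as a cone in $V$) is the closure of a connected component of the complement of the mirrors in $V$ (Euclidean case), respectively in the set of timelike vectors $\{v : v^2<0\}$ (Lorentzian case; so $C$ lies in one of the two halves of the cone $\{v^2\le 0\}$ and contains the lightlike vectors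 representing its ideal points). A simple root of $C$ is a root $\alpha$ of $W$ that is orthogonal to a facet of $C$ (i.e. $C\cap\alpha^\perp$ spans $\alpha^\perp$) and has negative inner product with all vectors in the interior of $C$. **Lemma.** Let $L$ be a Euclidean or Lorentzian lattice, let $W\subseteq \mathrm{O}(L)$ be a subgroup generated by reflections in roots of $L$, and let $k\in V$ be nonzero (the control vector); if $L$ is Lorentzian, assume that $k$ is timelike or lightlike, i.e. $k^2\le 0$. Let $C$ be a chamber of $W$ containing $k$, and let $B_0$ be the set of simple roots of $C$ that are orthogonal to $k$. Define the priority of a vector $\alpha$ of positive norm as $-k\cdot\alpha/\sqrt{\alpha^2}$. Let $\beta_1,\beta_2,\dots$ be a finite or infinite sequence of almost-roots of $W$, having negative inner products with $k$, such that 1. they have nonpositive inner products with all members of $B_0$; 2. they include all the simple roots of $C$ other than those in $B_0$; 3. they appear in nondecreasing order of priority; 4. those with equal priority appear in nondecreasing order of norm. Inductively call $\beta_i$ approved if it has nonpositive inner product with every $\beta_j$, $j<i$, that was approved. Then the set of approved $\beta_i$ is exactly the set of simple roots of $C$ that are not in $B_0$. -/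

import Mathlib

/-!
A lattice with its rational inner product is presented inside its real span: `V` is `L ⊗ ℝ`, a
finite-dimensional real vector space with a symmetric bilinear form `B`, and `L` is a full-rank
`ℤ`-lattice in `V` on which `B` takes rational values. (A norm on `V` serves only to give `V` its
usual topology.)
-/

namespace ReflLattice

variable {V : Type*} [NormedAddCommGroup V] [NormedSpace ℝ V]

/-- `L` carries a `ℚ`-valued inner product. -/
def IsRationalOn (B : LinearMap.BilinForm ℝ V) (L : Submodule ℤ V) : Prop :=
  ∀ x ∈ L, ∀ y ∈ L, ∃ q : ℚ, B x y = (q : ℝ)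

/-- Positive definite. -/
def IsEuclidean (B : LinearMap.BilinForm ℝ V) : Prop :=
  ∀ v : V, v ≠ 0 → 0 < B v v

/-- Signature `(n, 1)` with `n ≥ 1`: the space is the orthogonal direct sum of an
`n`-dimensional positive definite subspace and a `1`-dimensional negative definite subspace. -/
def IsLorentzian (B : LinearMap.BilinForm ℝ V) : Prop :=
  ∃ P N : Submodule ℝ V, IsCompl P N ∧
    1 ≤ Module.finrank ℝ P ∧ Module.finrank ℝ N = 1 ∧
    (∀ x ∈ P, ∀ y ∈ N, B x y = 0) ∧
    (∀ x ∈ P, x ≠ 0 → 0 < B x x) ∧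
    (∀ y ∈ N, y ≠ 0 → B y y < 0)

/-- The isometry group `O(L)`, each isometry of `L` being identified with its linear extension
to the real span of `L`. -/
def orthogonalGroup (B : LinearMap.BilinForm ℝ V) (L : Submodule ℤ V) :
    Subgroup (V ≃ₗ[ℝ] V) where
  carrier := {g | (∀ x y, B (g x) (g y) = B x y) ∧ ∀ x, g x ∈ L ↔ x ∈ L}
  mul_mem' := by
    intro g h hg hh
    refine ⟨fun x y => ?_, fun x => ?_⟩
    · exact (hg.1 (h x) (h y)).trans (hh.1 x y)
    · exact (hg.2 (h x)).trans (hh.2 x)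
  one_mem' := ⟨fun _ _ => rfl, fun _ => Iff.rfl⟩
  inv_mem' := by
    intro g hg
    have hgi : ∀ x, g (g⁻¹ x) = x := fun x => g.apply_symm_apply x
    refine ⟨fun x y => ?_, fun x => ?_⟩
    · have h := hg.1 (g⁻¹ x) (g⁻¹ y)
      rw [hgi, hgi] at h
      exact h.symm
    · have h := hg.2 (g⁻¹ x)
      rw [hgi] at h
      exact h.symm

/-- `α ∈ L` is an almost-root of `L`: `α² > 0` and `α · L ⊆ (α² / 2) ℤ`. -/
def IsAlmostRoot (B : LinearMap.BilinForm ℝ V) (L : Submodule ℤ V) (α : V) : Prop :=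
  α ∈ L ∧ 0 < B α α ∧ ∀ x ∈ L, ∃ m : ℤ, B α x = B α α / 2 * (m : ℝ)

/-- `α` is primitive in `L`: the quotient of `L` by the subgroup generated by `α` is
torsion-free. -/
def IsPrimitive (L : Submodule ℤ V) (α : V) : Prop :=
  ∀ x ∈ L, ∀ n : ℤ, n ≠ 0 →
    n • x ∈ Submodule.span ℤ ({α} : Set V) → x ∈ Submodule.span ℤ ({α} : Set V)

/-- A root of `L` is a primitive almost-root. -/
def IsRoot (B : LinearMap.BilinForm ℝ V) (L : Submodule ℤ V) (α : V) : Prop :=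
  IsAlmostRoot B L α ∧ IsPrimitive L α

/-- The reflection `x ↦ x - 2 (x · α) α / α²`. -/
noncomputable def reflectionMap (B : LinearMap.BilinForm ℝ V) (α : V) : V →ₗ[ℝ] V :=
  LinearMap.id - (2 / B α α) • (B α).smulRight α

/-- `W` is generated by reflections (in roots of `L`). -/
def IsGeneratedByReflections (B : LinearMap.BilinForm ℝ V) (L : Submodule ℤ V)
    (W : Subgroup (V ≃ₗ[ℝ] V)) : Prop :=
  ∃ S : Set (V ≃ₗ[ℝ] V),
    (∀ g ∈ S, ∃ α, IsRoot B L α ∧ (g : V →ₗ[ℝ] V) = reflectionMap B α) ∧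
    W = Subgroup.closure S

/-- The almost-roots of `W`: the almost-roots of `L` whose reflections belong to `W`. -/
def IsAlmostRootOf (B : LinearMap.BilinForm ℝ V) (L : Submodule ℤ V)
    (W : Subgroup (V ≃ₗ[ℝ] V)) (α : V) : Prop :=
  IsAlmostRoot B L α ∧ ∃ g ∈ W, (g : V →ₗ[ℝ] V) = reflectionMap B α

/-- The roots of `W`: the roots of `L` whose reflections belong to `W`. -/
def IsRootOf (B : LinearMap.BilinForm ℝ V) (L : Submodule ℤ V)
    (W : Subgroup (V ≃ₗ[ℝ] V)) (α : V) : Prop :=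
  IsRoot B L α ∧ ∃ g ∈ W, (g : V →ₗ[ℝ] V) = reflectionMap B α

/-- The cone over the sphere (all of `V`) in the Euclidean case, and the cone over hyperbolic
space (the set of timelike vectors, with its two halves) in the Lorentzian case. -/
def modelCone (B : LinearMap.BilinForm ℝ V) : Set V :=
  {v | IsEuclidean B ∨ B v v < 0}

/-- The model cone with all mirrors of `W` removed. -/
def mirrorComplement (B : LinearMap.BilinForm ℝ V) (L : Submodule ℤ V)
    (W : Subgroup (V ≃ₗ[ℝ] V)) : Set V :=
  {v | v ∈ modelCone B ∧ ∀ α, IsRootOf B L W α → B α v ≠ 0}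

/-- `C` is (the cone over) a chamber of `W`: the closure of a connected component of the
complement of the mirrors. In the Lorentzian case such a component lies in one of the two halves
of the cone of timelike vectors, which then is the future one, and the closure adds the lightlike
vectors that represent ideal points of the chamber (and the zero vector). -/
def IsChamber (B : LinearMap.BilinForm ℝ V) (L : Submodule ℤ V)
    (W : Subgroup (V ≃ₗ[ℝ] V)) (C : Set V) : Prop :=
  ∃ x ∈ mirrorComplement B L W,
    C = closure (connectedComponentIn (mirrorComplement B L W) x)

/-- The simple roots of the chamber `C` of `W`: the roots of `W` that are orthogonal to a facet
of `C` (that is, `C ∩ α^⊥` has codimension one: it spans `α^⊥`) and have negative inner products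
with the vectors in the interior of `C`. -/
def simpleRoots (B : LinearMap.BilinForm ℝ V) (L : Submodule ℤ V)
    (W : Subgroup (V ≃ₗ[ℝ] V)) (C : Set V) : Set V :=
  {α | IsRootOf B L W α ∧
    Submodule.span ℝ {v | v ∈ C ∧ B α v = 0} = LinearMap.ker (B α) ∧
    ∀ v ∈ interior C, B α v < 0}

/-- Batch zero: the simple roots of `C` that are orthogonal to `k`. -/
def batchZero (B : LinearMap.BilinForm ℝ V) (L : Submodule ℤ V)
    (W : Subgroup (V ≃ₗ[ℝ] V)) (C : Set V) (k : V) : Set V :=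
  {α | α ∈ simpleRoots B L W C ∧ B α k = 0}

/-- The priority `-(k · α) / √(α²)` of `α` with respect to the control vector `k`. -/
noncomputable def priority (B : LinearMap.BilinForm ℝ V) (k α : V) : ℝ :=
  -(B k α) / Real.sqrt (B α α)

/-- The `i`-th term of a sequence is approved if it has nonpositive inner product with all of
its approved predecessors. -/
def Approved (B : LinearMap.BilinForm ℝ V) (β : ℕ → V) (i : ℕ) : Prop :=
  ∀ j : ℕ, ∀ _ : j < i, Approved B β j → B (β i) (β j) ≤ 0
termination_by i

end ReflLattice

open ReflLattice

/-!
Let `D` be the open chamber with closure `C`, and let `β` be an almost-root of `W` with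
`β · k < 0`; then `β` is negative on `D`. The heart of the matter is that, if `β` is not simple and
has nonpositive inner products with the simple roots orthogonal to `k`, then some simple root `α`
not orthogonal to `k` has `α · β > 0` and comes before `β` in the order by priority and norm
(`exists_preceding_simpleRoot`). Since distinct simple roots have nonpositive inner products
(`inner_simpleRoots_nonpos`), induction along the sequence then shows that a term is approved
exactly if it is the first occurrence of a simple root.

To find `α`, project `k` orthogonally to a point `q` of the mirror of `β`. The mirror of `β` does
not meet `D`, so a wall of the chamber separates `k` from `q` in the weak sense: there is a simple
root `α` with `α · β > 0` and `α · q ≥ 0` (`exists_separating_simpleRoot`). The second inequality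
says that the priority of `α` is at most `(α · β) / (|α| |β|)` times that of `β`. If this factor is
less than `1`, the priority of `α` is smaller. If not, the difference of the normalized vectors
`β / |β|` and `α / |α|` is zero or nonspacelike; in the latter case it points to the future, whence
again the priority of `α` is smaller. It remains that `β` is a positive multiple of `α`, in which
case the priorities agree and `β` is the longer vector (`priority_lt_or_eq_smul`,
`eq_or_lt_of_pos_smul_root`).

That a point outside of `D` is on the wrong side of a wall (`exists_simpleRoot_nonneg`) rests on the
local finiteness of the mirrors in the model cone (`finite_almostRoots_meeting_compact`): if the
mirror of `α` meets a compact set, then `α²` is at least a constant times `‖α‖²`, whereas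
`α · L ⊆ (α² / 2) ℤ` bounds `α²` above by a constant times `‖α‖`.
-/

namespace ReflLattice

variable {V : Type*} [NormedAddCommGroup V] [NormedSpace ℝ V]
  {B : LinearMap.BilinForm ℝ V} {L : Submodule ℤ V} {W : Subgroup (V ≃ₗ[ℝ] V)}

/-! ### Orthogonal complements of timelike vectors -/

/-- Two vectors spanning a negative semidefinite plane would meet the positive definite summand,
which has codimension one. -/
lemma pos_of_orthogonal_timelike (hsymm : B.IsSymm) (hL : IsLorentzian B) {x a : V}
    (hx : B x x < 0) (hxa : B x a = 0) (ha : a ≠ 0) : 0 < B a a := by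
  obtain ⟨P, N, hPN, -, hN1, -, hP, -⟩ := hL
  by_contra! hneg
  obtain ⟨e, -, he⟩ := finrank_eq_one_iff'.1 hN1
  have hdec : ∀ v : V, ∃ s : ℝ, v - s • (e : V) ∈ P := by
    intro v
    obtain ⟨p, hp, n, hn, rfl⟩ : ∃ p ∈ P, ∃ n ∈ N, p + n = v := by
      rw [← Submodule.mem_sup, hPN.sup_eq_top]; trivial
    obtain ⟨s, hs⟩ := he ⟨n, hn⟩
    refine ⟨s, ?_⟩
    have : s • (e : V) = n := congrArg Subtype.val hs
    rwa [this, add_sub_cancel_right]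
  obtain ⟨s, hs⟩ := hdec x
  obtain ⟨r, hr⟩ := hdec a
  have hzP : r • x - s • a ∈ P := by
    have h := P.sub_mem (P.smul_mem r hs) (P.smul_mem s hr)
    convert h using 1
    module
  have hzz : B (r • x - s • a) (r • x - s • a) = r ^ 2 * B x x + s ^ 2 * B a a := by
    have hax : B a x = 0 := by rw [hsymm.eq]; exact hxa
    simp only [map_sub, map_smul, LinearMap.sub_apply, LinearMap.smul_apply, smul_eq_mul, hxa, hax]
    ring
  have hz0 : r • x - s • a = 0 := by
    by_contra h
    have := hP _ hzP h
    rw [hzz] at this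
    nlinarith [mul_nonneg (sq_nonneg r) (neg_nonneg.2 hx.le),
      mul_nonneg (sq_nonneg s) (neg_nonneg.2 hneg)]
  have hr0 : r = 0 := by
    by_contra h
    rw [hz0] at hzz
    simp only [map_zero] at hzz
    nlinarith [mul_pos (sq_pos_of_ne_zero h) (neg_pos.2 hx),
      mul_nonneg (sq_nonneg s) (neg_nonneg.2 hneg)]
  rw [hr0, zero_smul, sub_zero] at hr
  exact absurd (hP a hr ha) (not_lt.2 hneg)

/-- The orthogonal complement of a vector of the model cone is positive definite. -/
lemma pos_of_orthogonal_mem_modelCone (hsymm : B.IsSymm) (hL : IsEuclidean B ∨ IsLorentzian B)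
    {x a : V} (hx : x ∈ modelCone B) (hxa : B x a = 0) (ha : a ≠ 0) : 0 < B a a := by
  rcases hx with hE | hx
  · exact hE a ha
  · rcases hL with hE | hL
    · exact hE a ha
    · exact pos_of_orthogonal_timelike hsymm hL hx hxa ha

lemma IsLorentzian.not_isEuclidean (hL : IsLorentzian B) : ¬ IsEuclidean B := by
  obtain ⟨P, N, -, -, hN1, -, -, hN⟩ := hL
  intro hE
  obtain ⟨e, he, -⟩ := finrank_eq_one_iff'.1 hN1
  have he' : (e : V) ≠ 0 := fun h => he (Subtype.ext h)
  exact lt_asymm (hN e e.2 he') (hE e he')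

lemma self_combo_orthogonal (hsymm : B.IsSymm) (x y z : V) :
    B (B x z • y - B x y • z) (B x z • y - B x y • z) =
      (B x z) ^ 2 * B y y + (B x y) ^ 2 * B z z - 2 * (B x z * B x y) * B y z := by
  simp only [map_sub, map_smul, LinearMap.sub_apply, LinearMap.smul_apply, smul_eq_mul,
    hsymm.eq z y]
  ring

/-- Reversed Cauchy–Schwarz: nonspacelike vectors on the same side of `x^⊥`, with `x` timelike,
have nonpositive inner product, because a combination of them lies in the positive definite
space `x^⊥`. -/
lemma inner_nonpos_of_nonspacelike (hsymm : B.IsSymm) (hL : IsLorentzian B) {x y z : V}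
    (hx : B x x < 0) (hy : B y y ≤ 0) (hz : B z z ≤ 0) (hxy : B x y < 0) (hxz : B x z < 0) :
    B y z ≤ 0 := by
  have hw : 0 ≤ B (B x z • y - B x y • z) (B x z • y - B x y • z) := by
    by_cases h0 : B x z • y - B x y • z = 0
    · rw [h0]; simp
    · refine (pos_of_orthogonal_timelike hsymm hL hx ?_ h0).le
      simp only [map_sub, map_smul, smul_eq_mul]
      ring
  rw [self_combo_orthogonal hsymm] at hw
  have h1 : 0 < B x z * B x y := mul_pos_of_neg_of_neg hxz hxy
  by_contra! h
  nlinarith [mul_pos h1 h, mul_nonneg (sq_nonneg (B x z)) (neg_nonneg.2 hy),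
    mul_nonneg (sq_nonneg (B x y)) (neg_nonneg.2 hz)]

/-- The equality case of the reversed Cauchy–Schwarz inequality. -/
lemma proportional_of_nonspacelike (hsymm : B.IsSymm) (hL : IsLorentzian B) {x y z : V}
    (hx : B x x < 0) (hy : B y y ≤ 0) (hz : B z z ≤ 0) (hxz : B x z < 0)
    (hyz : B y z = 0) : ∃ c : ℝ, y = c • z := by
  refine ⟨B x y / B x z, ?_⟩
  have h0 : B x z • y - B x y • z = 0 := by
    by_contra h0
    have hw := pos_of_orthogonal_timelike hsymm hL hx (a := B x z • y - B x y • z) (by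
      simp only [map_sub, map_smul, smul_eq_mul]
      ring) h0
    rw [self_combo_orthogonal hsymm, hyz] at hw
    nlinarith [mul_nonneg (sq_nonneg (B x z)) (neg_nonneg.2 hy),
      mul_nonneg (sq_nonneg (B x y)) (neg_nonneg.2 hz)]
  rw [div_eq_inv_mul, mul_smul, ← sub_eq_zero.1 h0, smul_smul, inv_mul_cancel₀ hxz.ne, one_smul]

lemma inner_ne_zero_of_nonspacelike (hsymm : B.IsSymm) (hL : IsLorentzian B) {x y : V}
    (hx : B x x < 0) (hy : B y y ≤ 0) (hy0 : y ≠ 0) : B x y ≠ 0 := fun h =>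
  (pos_of_orthogonal_timelike hsymm hL hx h hy0).not_ge hy

/-! ### The half of the model cone that contains a given point -/

/-- The connected component of a vector `x` of the model cone: everything in the Euclidean case, the
timelike vectors in the same half as `x` in the Lorentzian case. -/
def futureCone (B : LinearMap.BilinForm ℝ V) (x : V) : Set V :=
  {v | IsEuclidean B ∨ (B v v < 0 ∧ B x v < 0)}

lemma futureCone_subset_modelCone (x : V) : futureCone B x ⊆ modelCone B :=
  fun _ hv => hv.imp id And.left

lemma mem_futureCone_self {x : V} (hx : x ∈ modelCone B) : x ∈ futureCone B x :=
  hx.imp id fun h => ⟨h, h⟩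

lemma mem_modelCone_of_lorentzian (hL : IsLorentzian B) {x : V} (hx : x ∈ modelCone B) :
    B x x < 0 :=
  hx.resolve_left hL.not_isEuclidean

lemma convex_futureCone (hsymm : B.IsSymm) (hL : IsEuclidean B ∨ IsLorentzian B) {x : V}
    (hx : x ∈ modelCone B) : Convex ℝ (futureCone B x) := by
  rcases hL with hE | hL
  · intro y _ z _ a b _ _ _
    exact Or.inl hE
  · intro y hy z hz a b ha hb hab
    have hx := mem_modelCone_of_lorentzian hL hx
    obtain ⟨hy1, hy2⟩ := hy.resolve_left hL.not_isEuclidean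
    obtain ⟨hz1, hz2⟩ := hz.resolve_left hL.not_isEuclidean
    have hyz := inner_nonpos_of_nonspacelike hsymm hL hx hy1.le hz1.le hy2 hz2
    refine Or.inr ⟨?_, ?_⟩
    · simp only [map_add, map_smul, LinearMap.add_apply, LinearMap.smul_apply, smul_eq_mul,
        hsymm.eq z y]
      have h1 : 0 ≤ a * b * -(B y z) := by have := neg_nonneg.2 hyz; positivity
      rcases ha.eq_or_lt with rfl | ha
      · have : b = 1 := by linarith
        subst this; linarith
      · nlinarith [mul_pos (mul_pos ha ha) (neg_pos.2 hy1),
          mul_nonneg (mul_nonneg hb hb) (neg_nonneg.2 hz1.le)]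
    · simp only [map_add, map_smul, smul_eq_mul]
      rcases ha.eq_or_lt with rfl | ha
      · have : b = 1 := by linarith
        subst this; linarith
      · nlinarith [mul_pos ha (neg_pos.2 hy2), mul_nonneg hb (neg_nonneg.2 hz2.le)]

section Topology

variable [FiniteDimensional ℝ V]

lemma continuous_form (B : LinearMap.BilinForm ℝ V) : Continuous fun p : V × V => B p.1 p.2 := by
  have h : Continuous fun v : V => LinearMap.toContinuousLinearMap (B v) :=
    LinearMap.continuous_of_finiteDimensional
      ((LinearMap.toContinuousLinearMap : (V →ₗ[ℝ] ℝ) ≃ₗ[ℝ] (V →L[ℝ] ℝ)).toLinearMap ∘ₗ B)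
  exact (h.comp continuous_fst).clm_apply continuous_snd

lemma continuous_form_left (B : LinearMap.BilinForm ℝ V) (v : V) : Continuous fun w => B v w :=
  (continuous_form B).comp (by fun_prop : Continuous fun w : V => (v, w))

lemma continuous_form_self (B : LinearMap.BilinForm ℝ V) : Continuous fun v => B v v :=
  (continuous_form B).comp (by fun_prop : Continuous fun w : V => (w, w))

lemma isOpen_futureCone (x : V) : IsOpen (futureCone B x) := by
  by_cases hE : IsEuclidean B
  · convert isOpen_univ
    exact Set.eq_univ_of_forall fun _ => Or.inl hE
  · have : futureCone B x = {v | B v v < 0} ∩ {v | B x v < 0} := by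
      ext v; simp [futureCone, hE]
    rw [this]
    exact (isOpen_lt (continuous_form_self B) continuous_const).inter
      (isOpen_lt (continuous_form_left B x) continuous_const)

/-! ### Local finiteness of the mirrors -/

/-- Positive definiteness of the spaces `x^⊥`, uniformly for `x` in a compact set. -/
lemma exists_uniform_pos (hsymm : B.IsSymm) (hL : IsEuclidean B ∨ IsLorentzian B) {Q : Set V}
    (hQ : IsCompact Q) (hQB : Q ⊆ modelCone B) :
    ∃ c > 0, ∀ x ∈ Q, ∀ a, B x a = 0 → c * ‖a‖ ^ 2 ≤ B a a := by
  let K : Set (V × V) := (Q ×ˢ Metric.sphere 0 1) ∩ {p | B p.1 p.2 = 0}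
  have hK : IsCompact K := (hQ.prod (isCompact_sphere 0 1)).inter_right
    (isClosed_eq (continuous_form B) continuous_const)
  have hpos : ∀ p ∈ K, 0 < B p.2 p.2 := by
    rintro ⟨x, a⟩ ⟨⟨hx, ha⟩, hxa⟩
    refine pos_of_orthogonal_mem_modelCone hsymm hL (hQB hx) hxa ?_
    rintro (rfl : a = 0)
    simp at ha
  obtain ⟨c, hc, hcK⟩ : ∃ c > 0, ∀ p ∈ K, c ≤ B p.2 p.2 := by
    rcases K.eq_empty_or_nonempty with h | h
    · exact ⟨1, one_pos, by simp [h]⟩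
    · obtain ⟨p, hp, hmin⟩ := hK.exists_isMinOn h
        ((continuous_form_self B).comp continuous_snd).continuousOn
      exact ⟨_, hpos p hp, fun q hq => hmin hq⟩
  refine ⟨c, hc, fun x hx a hxa => ?_⟩
  rcases eq_or_ne a 0 with rfl | ha
  · simp
  have hn : 0 < ‖a‖ := norm_pos_iff.2 ha
  have h := hcK (x, ‖a‖⁻¹ • a) ⟨⟨hx, by simp [norm_smul, hn.ne']⟩, by simp [hxa]⟩
  simp only [map_smul, LinearMap.smul_apply, smul_eq_mul] at h
  calc c * ‖a‖ ^ 2 ≤ (‖a‖⁻¹ * (‖a‖⁻¹ * B a a)) * ‖a‖ ^ 2 := by gcongr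
    _ = B a a := by field_simp

/-- Some element `s` of a finite generating set of `L` is not orthogonal to a given almost-root
`α`, and then `α² / 2 ≤ |α · s|`. -/
lemma exists_self_le_mul_norm [DiscreteTopology L] [IsZLattice ℝ L] :
    ∃ E : ℝ, ∀ α, IsAlmostRoot B L α → B α α ≤ E * ‖α‖ := by
  obtain ⟨S, hS⟩ := ZLattice.FG ℝ L
  have hbound : ∃ E : ℝ, 0 ≤ E ∧ ∀ s ∈ S, ∀ α : V, |B α s| ≤ E * ‖α‖ := by
    let f : V → V →L[ℝ] ℝ := fun s => LinearMap.toContinuousLinearMap (B.flip s)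
    refine ⟨∑ s ∈ S, ‖f s‖, Finset.sum_nonneg fun _ _ => norm_nonneg _, fun s hs α => ?_⟩
    calc |B α s| = ‖f s α‖ := rfl
      _ ≤ ‖f s‖ * ‖α‖ := (f s).le_opNorm α
      _ ≤ _ := by
        gcongr
        exact Finset.single_le_sum (f := fun s => ‖f s‖) (fun _ _ => norm_nonneg _) hs
  obtain ⟨E, hE, hb⟩ := hbound
  refine ⟨2 * E, fun α hα => ?_⟩
  obtain ⟨s, hs, hs0⟩ : ∃ s ∈ S, B α s ≠ 0 := by
    by_contra! h
    have h1 : L ≤ (LinearMap.ker (B α)).restrictScalars ℤ := by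
      rw [← hS, Submodule.span_le]
      intro s hs
      exact h s hs
    exact hα.2.1.ne' (h1 hα.1)
  have hsL : s ∈ L := hS ▸ Submodule.subset_span hs
  obtain ⟨m, hm⟩ := hα.2.2 s hsL
  have hm0 : m ≠ 0 := by rintro rfl; simp [hm] at hs0
  have hm1 : (1 : ℝ) ≤ |(m : ℝ)| := by exact_mod_cast Int.one_le_abs hm0
  have h2 := hb s hs α
  rw [hm, abs_mul, abs_of_pos (half_pos hα.2.1)] at h2
  nlinarith [hα.2.1]

/-- Only finitely many mirrors meet a compact subset of the model cone. -/
lemma finite_almostRoots_meeting_compact (hsymm : B.IsSymm) (hL : IsEuclidean B ∨ IsLorentzian B)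
    [DiscreteTopology L] [IsZLattice ℝ L] {Q : Set V} (hQ : IsCompact Q) (hQB : Q ⊆ modelCone B) :
    {α | IsAlmostRoot B L α ∧ ∃ x ∈ Q, B α x = 0}.Finite := by
  obtain ⟨c, hc, hcQ⟩ := exists_uniform_pos hsymm hL hQ hQB
  obtain ⟨E, hE⟩ := exists_self_le_mul_norm (B := B) (L := L)
  have hfin : (Metric.closedBall (0 : V) (E / c) ∩ (L : Set V)).Finite :=
    Metric.finite_isBounded_inter_isClosed DiscreteTopology.isDiscrete Metric.isBounded_closedBall
      (AddSubgroup.isClosed_of_discrete (H := L.toAddSubgroup))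
  refine hfin.subset ?_
  rintro α ⟨hα, x, hx, hαx⟩
  refine ⟨?_, hα.1⟩
  have hα0 : 0 < ‖α‖ := norm_pos_iff.2 fun h => hα.2.1.ne' (by simp [h])
  have h := (hcQ x hx α (by rw [hsymm.eq]; exact hαx)).trans (hE α hα)
  rw [mem_closedBall_zero_iff, le_div_iff₀ hc]
  nlinarith

end Topology

/-! ### Roots and almost-roots -/

lemma reflectionMap_apply (α x : V) :
    reflectionMap B α x = x - (2 / B α α * B α x) • α := by
  simp [reflectionMap, smul_smul]

lemma reflectionMap_smul {c : ℝ} (hc : c ≠ 0) (α : V) :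
    reflectionMap B (c • α) = reflectionMap B α := by
  ext x
  simp only [reflectionMap_apply, map_smul, LinearMap.smul_apply, smul_eq_mul, smul_smul]
  congr 2
  field_simp

lemma IsRootOf.isAlmostRootOf {α : V} (h : IsRootOf B L W α) : IsAlmostRootOf B L W α :=
  ⟨h.1.1, h.2⟩

lemma IsAlmostRoot.neg {α : V} (h : IsAlmostRoot B L α) : IsAlmostRoot B L (-α) := by
  obtain ⟨h1, h2, h3⟩ := h
  refine ⟨L.neg_mem h1, by simpa using h2, fun x hx => ?_⟩
  obtain ⟨m, hm⟩ := h3 x hx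
  exact ⟨-m, by simp [hm]⟩

lemma IsAlmostRootOf.neg {α : V} (h : IsAlmostRootOf B L W α) : IsAlmostRootOf B L W (-α) := by
  obtain ⟨h1, g, hg, hgr⟩ := h
  refine ⟨h1.neg, g, hg, ?_⟩
  rw [hgr, ← neg_one_smul ℝ α, reflectionMap_smul (by norm_num)]

lemma IsRootOf.neg {α : V} (h : IsRootOf B L W α) : IsRootOf B L W (-α) := by
  refine ⟨⟨h.1.1.neg, ?_⟩, h.isAlmostRootOf.neg.2⟩
  have h2 := h.1.2
  have hspan : Submodule.span ℤ {-α} = Submodule.span ℤ {α} := by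
    rw [← Set.neg_singleton, Submodule.span_neg]
  intro x hx n hn
  rw [hspan]
  exact h2 x hx n hn

/-- A multiple of an almost-root `α` that lies in `L` is a half-integral multiple, since
`α · L ⊆ (α² / 2) ℤ`. -/
lemma IsAlmostRoot.two_smul_eq {α x : V} (h : IsAlmostRoot B L α) (hx : x ∈ L) {c : ℝ}
    (hxc : x = c • α) : ∃ l : ℤ, c = l / 2 ∧ (2 : ℤ) • x = l • α := by
  obtain ⟨l, hl⟩ := h.2.2 x hx
  have hc : c = l / 2 := by
    rw [hxc, map_smul, smul_eq_mul] at hl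
    have := h.2.1.ne'
    field_simp at hl ⊢
    linarith
  refine ⟨l, hc, ?_⟩
  rw [← Int.cast_smul_eq_zsmul ℝ, ← Int.cast_smul_eq_zsmul ℝ, hxc, smul_smul, hc]
  congr 1
  push_cast
  ring

lemma IsAlmostRoot.isPrimitive {α : V} (h : IsAlmostRoot B L α)
    (h2 : ∀ y ∈ L, (2 : ℤ) • y ≠ α) : IsPrimitive L α := by
  intro x hx n hn hnx
  obtain ⟨j, hj⟩ := Submodule.mem_span_singleton.1 hnx
  have hn' : (n : ℝ) ≠ 0 := by exact_mod_cast hn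
  have hxc : x = ((j : ℝ) / n) • α := by
    rw [← Int.cast_smul_eq_zsmul ℝ, ← Int.cast_smul_eq_zsmul ℝ] at hj
    rw [div_eq_inv_mul, mul_smul, hj, smul_smul, inv_mul_cancel₀ hn', one_smul]
  obtain ⟨l, -, hl⟩ := h.two_smul_eq hx hxc
  rw [Submodule.mem_span_singleton]
  rcases Int.even_or_odd' l with ⟨m, rfl | rfl⟩
  · refine ⟨m, ?_⟩
    rw [mul_smul] at hl
    have := congrArg (fun y => (2 : ℝ)⁻¹ • y) hl
    simpa [← Int.cast_smul_eq_zsmul ℝ, smul_smul] using this.symm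
  · exfalso
    refine h2 (x - m • α) (L.sub_mem hx (L.smul_mem m h.1)) ?_
    rw [smul_sub, hl]
    module

/-- An almost-root is a positive multiple of a root, namely of itself or of its half. -/
lemma IsAlmostRootOf.exists_root {β : V} (h : IsAlmostRootOf B L W β) :
    ∃ r, IsRootOf B L W r ∧ ∃ m : ℝ, 0 < m ∧ β = m • r := by
  by_cases h2 : ∀ y ∈ L, (2 : ℤ) • y ≠ β
  · exact ⟨β, ⟨⟨h.1, h.1.isPrimitive h2⟩, h.2⟩, 1, one_pos, (one_smul _ _).symm⟩
  push Not at h2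
  obtain ⟨r, hr, rfl⟩ := h2
  rw [← Int.cast_smul_eq_zsmul ℝ] at h ⊢
  obtain ⟨⟨-, hpos, hint⟩, g, hg, hgr⟩ := h
  simp only [map_smul, LinearMap.smul_apply, smul_eq_mul, Int.cast_ofNat] at hpos hint
  have har : IsAlmostRoot B L r := by
    refine ⟨hr, by linarith, fun x hx => ?_⟩
    obtain ⟨m, hm⟩ := hint x hx
    exact ⟨2 * m, by push_cast; linarith⟩
  refine ⟨r, ⟨⟨har, har.isPrimitive ?_⟩, g, hg, ?_⟩, 2, two_pos, by simp⟩
  · rintro y hy rfl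
    obtain ⟨m, hm⟩ := hint y hy
    rw [← Int.cast_smul_eq_zsmul ℝ] at hm hpos
    simp only [map_smul, LinearMap.smul_apply, smul_eq_mul, Int.cast_ofNat] at hm hpos
    have h4 : 0 < B y y := by linarith
    have : (1 : ℝ) = 2 * m := by
      have : B y y * 1 = B y y * (2 * m) := by linarith
      exact mul_left_cancel₀ h4.ne' this
    have : (1 : ℤ) = 2 * m := by exact_mod_cast this
    omega
  · rw [hgr, reflectionMap_smul (by norm_num)]

/-- An almost-root on the ray of a root `α` is `α` itself or is longer. -/
lemma eq_or_lt_of_pos_smul_root {α β : V} (hα : IsRoot B L α) (hβ : IsAlmostRoot B L β) {c : ℝ}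
    (hc : 0 < c) (h : β = c • α) : β = α ∨ B α α < B β β := by
  obtain ⟨l, hl, hl2⟩ := hα.1.two_smul_eq hβ.1 h
  have hspan := hα.2 β hβ.1 2 two_ne_zero
    (hl2 ▸ Submodule.smul_mem _ _ (Submodule.mem_span_singleton_self α))
  obtain ⟨m, rfl⟩ := Submodule.mem_span_singleton.1 hspan
  have hα0 : α ≠ 0 := by rintro rfl; simpa using hα.1.2.1
  have hm : (m : ℝ) = c := by
    rw [← Int.cast_smul_eq_zsmul ℝ] at h
    exact smul_left_injective ℝ hα0 h
  have hm0 : 0 < m := by rw [← hm] at hc; exact_mod_cast hc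
  rcases (show m = 1 ∨ 2 ≤ m by omega) with rfl | h2
  · left; simp
  · right
    rw [← Int.cast_smul_eq_zsmul ℝ]
    simp only [map_smul, LinearMap.smul_apply, smul_eq_mul]
    have h2' : (2 : ℝ) ≤ m := by exact_mod_cast h2
    nlinarith [hα.1.2.1, mul_le_mul h2' h2' (by norm_num) (by linarith)]

lemma eq_of_pos_smul_root {α β : V} (hα : IsRoot B L α) (hβ : IsRoot B L β) {c : ℝ}
    (hc : 0 < c) (h : β = c • α) : β = α := by
  rcases eq_or_lt_of_pos_smul_root hα hβ.1 hc h with h1 | h1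
  · exact h1
  have h' : α = c⁻¹ • β := by rw [h, smul_smul, inv_mul_cancel₀ hc.ne', one_smul]
  rcases eq_or_lt_of_pos_smul_root hβ hα.1 (inv_pos.2 hc) h' with h2 | h2
  · exact h2.symm
  · exact absurd h1 h2.not_gt

/-- The almost-roots of `W` are permuted by the reflections in them. -/
lemma IsAlmostRootOf.reflect (hWO : W ≤ orthogonalGroup B L) {α β : V}
    (hα : IsAlmostRootOf B L W α) (hβ : IsAlmostRootOf B L W β) :
    IsAlmostRootOf B L W (β - (2 / B α α * B α β) • α) := by
  obtain ⟨-, g, hg, hgr⟩ := hα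
  obtain ⟨⟨hβL, hβ0, hβi⟩, h, hh, hhr⟩ := hβ
  have hgβ : β - (2 / B α α * B α β) • α = g β := by
    rw [← reflectionMap_apply, ← hgr]; rfl
  rw [hgβ]
  obtain ⟨hgB, hgL⟩ := hWO hg
  obtain ⟨-, hgL'⟩ := hWO (W.inv_mem hg)
  have hinv : ∀ x, g (g⁻¹ x) = x := fun x => g.apply_symm_apply x
  have hmove : ∀ x, B (g β) x = B β (g⁻¹ x) := fun x => by
    rw [← hgB β (g⁻¹ x), hinv]
  refine ⟨⟨(hgL β).2 hβL, by rwa [hgB], fun x hx => ?_⟩, g * h * g⁻¹,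
    W.mul_mem (W.mul_mem hg hh) (W.inv_mem hg), ?_⟩
  · rw [hmove, hgB]
    exact hβi _ ((hgL' x).2 hx)
  · ext x
    have h1 : h (g⁻¹ x) = reflectionMap B β (g⁻¹ x) := by rw [← hhr]; rfl
    change g (h (g⁻¹ x)) = _
    rw [h1, reflectionMap_apply, reflectionMap_apply, map_sub, map_smul, hinv, hgB, hmove]

/-! ### Priorities -/

lemma priority_lt_iff (hsymm : B.IsSymm) {k α β : V} (hα : 0 < B α α) (hβ : 0 < B β β) :
    priority B k α < priority B k β ↔
      √(B α α) * B β k < √(B β β) * B α k := by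
  rw [priority, priority, div_lt_div_iff₀ (Real.sqrt_pos.2 hα) (Real.sqrt_pos.2 hβ),
    hsymm.eq k α, hsymm.eq k β]
  constructor <;> intro h <;> linarith

lemma priority_smul {k α : V} {c : ℝ} (hc : 0 < c) : priority B k (c • α) = priority B k α := by
  have h : B (c • α) (c • α) = c ^ 2 * B α α := by
    simp only [map_smul, LinearMap.smul_apply, smul_eq_mul]; ring
  rw [priority, priority, h, Real.sqrt_mul (sq_nonneg c), Real.sqrt_sq hc.le, map_smul,
    smul_eq_mul, ← mul_neg, mul_div_mul_left _ _ hc.ne']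

/-! ### Chambers as intersections of half-spaces -/

/-- The roots of `W` that are negative at `x`. -/
def negativeRoots (B : LinearMap.BilinForm ℝ V) (L : Submodule ℤ V)
    (W : Subgroup (V ≃ₗ[ℝ] V)) (x : V) : Set V :=
  {α | IsRootOf B L W α ∧ B α x < 0}

/-- The open chamber that contains `x`, cut out of the half of the model cone around `x` by the
half-spaces on which the roots that are negative at `x` stay negative. -/
def openChamber (B : LinearMap.BilinForm ℝ V) (L : Submodule ℤ V)
    (W : Subgroup (V ≃ₗ[ℝ] V)) (x : V) : Set V :=
  {v | v ∈ futureCone B x ∧ ∀ α ∈ negativeRoots B L W x, B α v < 0}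

lemma mem_openChamber_self {x : V} (hx : x ∈ modelCone B) : x ∈ openChamber B L W x :=
  ⟨mem_futureCone_self hx, fun _ h => h.2⟩

lemma convex_openChamber (hsymm : B.IsSymm) (hL : IsEuclidean B ∨ IsLorentzian B) {x : V}
    (hx : x ∈ modelCone B) : Convex ℝ (openChamber B L W x) := by
  have : openChamber B L W x =
      futureCone B x ∩ ⋂ α ∈ negativeRoots B L W x, {v | B α v < 0} := by
    ext v; simp [openChamber]
  rw [this]
  exact (convex_futureCone hsymm hL hx).inter
    (convex_iInter₂ fun α _ => convex_halfSpace_lt (B α).isLinear 0)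

lemma openChamber_subset_mirrorComplement {x : V} (hx : x ∈ mirrorComplement B L W) :
    openChamber B L W x ⊆ mirrorComplement B L W := by
  rintro v ⟨hv, hneg⟩
  refine ⟨futureCone_subset_modelCone x hv, fun α hα h0 => ?_⟩
  rcases (hx.2 α hα).lt_or_gt with h | h
  · exact (hneg α ⟨hα, h⟩).ne h0
  · have := hneg (-α) ⟨hα.neg, by simpa using h⟩
    simp [h0] at this

variable [FiniteDimensional ℝ V]

/-- A component of the complement of the mirrors is an open chamber in the above sense: linear
forms without zeros on a connected set have constant sign, and conversely a convex set is
connected. -/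
lemma connectedComponentIn_mirrorComplement (hsymm : B.IsSymm)
    (hL : IsEuclidean B ∨ IsLorentzian B) {x : V} (hx : x ∈ mirrorComplement B L W) :
    connectedComponentIn (mirrorComplement B L W) x = openChamber B L W x := by
  apply Set.Subset.antisymm
  · intro v hv
    have hsub := connectedComponentIn_subset (mirrorComplement B L W) x
    have hsign : ∀ u : V, (∀ w ∈ mirrorComplement B L W, B u w ≠ 0) → B u x < 0 → B u v < 0 := by
      intro u hu hux
      by_contra! h
      obtain ⟨w, hw, hw0⟩ := isPreconnected_connectedComponentIn.intermediate_value
        (mem_connectedComponentIn hx) hv (continuous_form_left B u).continuousOn ⟨hux.le, h⟩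
      exact hu w (hsub hw) hw0
    refine ⟨?_, fun α hα => hsign α (fun w hw => hw.2 α hα.1) hα.2⟩
    rcases hL with hE | hL
    · exact Or.inl hE
    · have hxx := mem_modelCone_of_lorentzian hL hx.1
      refine Or.inr ⟨mem_modelCone_of_lorentzian hL (hsub hv).1,
        hsign x (fun w hw => ?_) hxx⟩
      have hww := mem_modelCone_of_lorentzian hL hw.1
      refine inner_ne_zero_of_nonspacelike hsymm hL hxx hww.le ?_
      rintro rfl
      simp at hww
  · exact (convex_openChamber hsymm hL hx.1).isPreconnected.subset_connectedComponentIn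
      (mem_openChamber_self hx.1) (openChamber_subset_mirrorComplement hx)

/-- Within a compact convex set, finitely many roots suffice to cut out the open chamber. -/
lemma exists_finset_cutting_out (hsymm : B.IsSymm) (hL : IsEuclidean B ∨ IsLorentzian B)
    [DiscreteTopology L] [IsZLattice ℝ L] {x y : V} {Q : Set V}
    (hQ : IsCompact Q) (hQc : Convex ℝ Q) (hQB : Q ⊆ futureCone B x) (hyQ : y ∈ Q)
    (hy : y ∈ openChamber B L W x) :
    ∃ F : Finset V, (∀ α ∈ F, α ∈ negativeRoots B L W x) ∧
      ∀ w ∈ Q, (∀ α ∈ F, B α w < 0) → w ∈ openChamber B L W x := by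
  have hfin := finite_almostRoots_meeting_compact (L := L) hsymm hL hQ
    (hQB.trans (futureCone_subset_modelCone x))
  have hfin' := hfin.subset (Set.inter_subset_left (t := negativeRoots B L W x))
  refine ⟨hfin'.toFinset, fun α hα => (hfin'.mem_toFinset.1 hα).2, fun w hw hF => ?_⟩
  refine ⟨hQB hw, fun α hα => ?_⟩
  by_contra! h
  obtain ⟨u, hu, hu0⟩ := hQc.isPreconnected.intermediate_value hyQ hw
    (continuous_form_left B α).continuousOn ⟨(hy.2 α hα).le, h⟩
  exact (hF α (hfin'.mem_toFinset.2 ⟨⟨hα.1.1.1, u, hu, hu0⟩, hα⟩)).not_ge h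

lemma isOpen_openChamber (hsymm : B.IsSymm) (hL : IsEuclidean B ∨ IsLorentzian B)
    [DiscreteTopology L] [IsZLattice ℝ L] (x : V) :
    IsOpen (openChamber B L W x) := by
  rw [isOpen_iff_mem_nhds]
  intro v hv
  obtain ⟨δ, hδ, hball⟩ := Metric.nhds_basis_closedBall.mem_iff.1
    ((isOpen_futureCone x).mem_nhds hv.1)
  obtain ⟨F, hF, hcut⟩ := exists_finset_cutting_out hsymm hL (isCompact_closedBall v δ)
    (convex_closedBall v δ) hball (Metric.mem_closedBall_self hδ.le) hv
  have h1 : ∀ᶠ w in nhds v, ∀ α ∈ F, B α w < 0 := by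
    rw [Filter.eventually_all_finset]
    exact fun α hα => (continuous_form_left B α).continuousAt.eventually_lt continuousAt_const
      (hv.2 α (hF α hα))
  filter_upwards [h1, Metric.closedBall_mem_nhds v hδ] with w hw1 hw2
  exact hcut w hw2 hw1

lemma nonpos_of_mem_closure {x v α : V} (hv : v ∈ closure (openChamber B L W x))
    (hα : α ∈ negativeRoots B L W x) : B α v ≤ 0 :=
  closure_minimal (fun _ hw => (hw.2 α hα).le)
    (isClosed_le (continuous_form_left B α) continuous_const) hv

lemma self_nonpos_of_mem_closure (hL : IsLorentzian B) {x v : V}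
    (hv : v ∈ closure (openChamber B L W x)) : B v v ≤ 0 :=
  closure_minimal (fun _ hw => ((hw.1.resolve_left hL.not_isEuclidean).1).le)
    (isClosed_le (continuous_form_self B) continuous_const) hv

lemma neg_of_mem_closure (hsymm : B.IsSymm) (hL : IsLorentzian B) {x v : V} (hx : x ∈ modelCone B)
    (hv : v ∈ closure (openChamber B L W x)) (hv0 : v ≠ 0) : B x v < 0 := by
  have hle : B x v ≤ 0 :=
    closure_minimal (fun _ hw => ((hw.1.resolve_left hL.not_isEuclidean).2).le)
      (isClosed_le (continuous_form_left B x) continuous_const) hv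
  exact lt_of_le_of_ne hle (inner_ne_zero_of_nonspacelike hsymm hL
    (mem_modelCone_of_lorentzian hL hx) (self_nonpos_of_mem_closure hL hv) hv0)

lemma neg_of_mem_interior_closure {x v α : V}
    (hv : v ∈ interior (closure (openChamber B L W x))) (hα : α ∈ negativeRoots B L W x) :
    B α v < 0 := by
  refine lt_of_le_of_ne (nonpos_of_mem_closure (interior_subset hv) hα) fun h0 => ?_
  -- Moving from a zero `v` of `α` in the direction of `α` makes `α` positive.
  have hcont : Filter.Tendsto (fun t : ℝ => v + t • α) (nhdsWithin 0 (Set.Ioi 0)) (nhds v) := by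
    have : Continuous fun t : ℝ => v + t • α := by fun_prop
    simpa using (this.tendsto 0).mono_left nhdsWithin_le_nhds
  obtain ⟨t, ht, ht0⟩ :=
    ((hcont.eventually (isOpen_interior.mem_nhds hv)).and self_mem_nhdsWithin).exists
  have h := nonpos_of_mem_closure (interior_subset ht) hα
  simp only [map_add, map_smul, smul_eq_mul, h0, zero_add] at h
  exact absurd (mul_pos ht0 hα.1.1.1.2.1) h.not_gt

/-- An almost-root of `W` that is negative somewhere on the closed chamber is negative on the whole
open chamber, being a positive multiple of a root. -/
lemma IsAlmostRootOf.neg_of_neg {x k β : V} (hx : x ∈ mirrorComplement B L W)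
    (hk : k ∈ closure (openChamber B L W x)) (hβ : IsAlmostRootOf B L W β) (hβk : B β k < 0) :
    (∀ v ∈ openChamber B L W x, B β v < 0) ∧
      ∀ v ∈ closure (openChamber B L W x), B β v ≤ 0 := by
  obtain ⟨r, hr, m, hm, rfl⟩ := hβ.exists_root
  simp only [map_smul, LinearMap.smul_apply, smul_eq_mul] at hβk ⊢
  have hrneg : r ∈ negativeRoots B L W x := by
    refine ⟨hr, lt_of_le_of_ne ?_ (hx.2 r hr)⟩
    by_contra! h
    have := nonpos_of_mem_closure hk (α := -r) ⟨hr.neg, by simpa using h⟩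
    simp only [map_neg, LinearMap.neg_apply] at this
    nlinarith
  exact ⟨fun v hv => mul_neg_of_pos_of_neg hm (hv.2 r hrneg),
    fun v hv => mul_nonpos_of_nonneg_of_nonpos hm.le (nonpos_of_mem_closure hv hrneg)⟩

lemma simpleRoots_subset_negativeRoots (hsymm : B.IsSymm) (hL : IsEuclidean B ∨ IsLorentzian B)
    [DiscreteTopology L] [IsZLattice ℝ L] {x : V} (hx : x ∈ modelCone B) :
    simpleRoots B L W (closure (openChamber B L W x)) ⊆ negativeRoots B L W x := fun _ hα =>
  ⟨hα.1, hα.2.2 x (interior_maximal subset_closure (isOpen_openChamber hsymm hL x)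
    (mem_openChamber_self hx))⟩

/-! ### Walls -/

/-- A point `v` of the half of the model cone around `x` that lies outside of the open chamber of
`x` is on the wrong side of a wall. In a compact convex neighbourhood of the segment from `x` to
`v` the chamber is cut out by finitely many roots. A minimal such set of roots contains one that
is nonnegative at `v`, and by minimality its mirror contains an open piece of the boundary. -/
lemma exists_simpleRoot_nonneg (hsymm : B.IsSymm) (hL : IsEuclidean B ∨ IsLorentzian B)
    [DiscreteTopology L] [IsZLattice ℝ L] {x v : V} (hx : x ∈ modelCone B)
    (hv : v ∈ futureCone B x) (hvD : v ∉ openChamber B L W x) :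
    ∃ α ∈ simpleRoots B L W (closure (openChamber B L W x)), 0 ≤ B α v := by
  classical
  have hseg : segment ℝ x v ⊆ futureCone B x :=
    (convex_futureCone hsymm hL hx).segment_subset (mem_futureCone_self hx) hv
  have hsegc : IsCompact (segment ℝ x v) := by
    rw [← Path.range_segment]
    exact isCompact_range (Path.segment x v).continuous
  obtain ⟨δ, hδ, hQ⟩ := hsegc.exists_cthickening_subset_open (isOpen_futureCone x) hseg
  have hUQ := Metric.thickening_subset_cthickening δ (segment ℝ x v)
  have hSU := Metric.self_subset_thickening hδ (segment ℝ x v)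
  have hUo : IsOpen (Metric.thickening δ (segment ℝ x v)) := Metric.isOpen_thickening
  have hUc : Convex ℝ (Metric.thickening δ (segment ℝ x v)) := (convex_segment x v).thickening δ
  obtain ⟨F₀, hF₀, hcut₀⟩ := exists_finset_cutting_out hsymm hL hsegc.cthickening
    ((convex_segment x v).cthickening δ) hQ (hUQ (hSU (left_mem_segment ℝ x v)))
    (mem_openChamber_self (L := L) (W := W) hx)
  generalize Metric.thickening δ (segment ℝ x v) = U at *
  obtain ⟨F, hFmin⟩ := exists_minimal_of_wellFoundedLT
    (fun F : Finset V => F ⊆ F₀ ∧ ∀ w ∈ U, (∀ α ∈ F, B α w < 0) → w ∈ openChamber B L W x)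
    ⟨F₀, subset_rfl, fun w hw => hcut₀ w (hUQ hw)⟩
  obtain ⟨hFF₀, hcut⟩ := hFmin.prop
  have hxU : x ∈ U := hSU (left_mem_segment ℝ x v)
  have hvU : v ∈ U := hSU (right_mem_segment ℝ x v)
  have hFneg : ∀ γ ∈ F, B γ x < 0 := fun γ hγ => (hF₀ γ (hFF₀ hγ)).2
  obtain ⟨α, hαF, hαv⟩ : ∃ α ∈ F, 0 ≤ B α v := by
    by_contra! h
    exact hvD (hcut v hvU h)
  have hα := hF₀ α (hFF₀ hαF)
  obtain ⟨z, hzU, hzneg, hzα⟩ :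
      ∃ z ∈ U, (∀ γ ∈ F.erase α, B γ z < 0) ∧ 0 ≤ B α z := by
    by_contra! h
    have hle := hFmin.le_of_le (y := F.erase α) ⟨(Finset.erase_subset _ _).trans hFF₀, ?_⟩
      (Finset.erase_subset _ _)
    · exact Finset.notMem_erase α F (hle hαF)
    · intro w hw hwneg
      refine hcut w hw fun γ hγ => ?_
      by_cases hγα : γ = α
      · exact hγα ▸ h w hw hwneg
      · exact hwneg γ (Finset.mem_erase.2 ⟨hγα, hγ⟩)
  -- The point `y` of the segment from `x` to `z` that lies on the mirror of `α`.
  obtain ⟨y, hyU, hyα, hyneg⟩ :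
      ∃ y ∈ U, B α y = 0 ∧ ∀ γ ∈ F.erase α, B γ y < 0 := by
    obtain ⟨y, hy, hy0⟩ := (convex_segment x z).isPreconnected.intermediate_value
      (left_mem_segment ℝ x z) (right_mem_segment ℝ x z)
      (continuous_form_left B α).continuousOn ⟨hα.2.le, hzα⟩
    refine ⟨y, hUc.segment_subset hxU hzU hy, hy0, fun γ hγ => ?_⟩
    exact (convex_halfSpace_lt (B γ).isLinear 0).segment_subset
      (hFneg γ (Finset.mem_of_mem_erase hγ)) (hzneg γ hγ) hy
  have hfacet : ∀ w ∈ U, B α w = 0 → (∀ γ ∈ F.erase α, B γ w < 0) →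
      w ∈ closure (openChamber B L W x) := by
    intro w hwU hwα hwneg
    have hopen : openSegment ℝ x w ⊆ openChamber B L W x := by
      intro u hu
      refine hcut u (hUc.segment_subset hxU hwU (openSegment_subset_segment ℝ x w hu))
        fun γ hγ => ?_
      by_cases hγα : γ = α
      · obtain ⟨a, b, ha, hb, -, rfl⟩ := hu
        subst hγα
        simp only [map_add, map_smul, smul_eq_mul, hwα, mul_zero, add_zero]
        exact mul_neg_of_pos_of_neg ha hα.2
      · exact (convex_halfSpace_lt (B γ).isLinear 0).segment_subset (hFneg γ hγ)
          (hwneg γ (Finset.mem_erase.2 ⟨hγα, hγ⟩)) (openSegment_subset_segment ℝ x w hu)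
    apply closure_mono hopen
    rw [closure_openSegment]
    exact right_mem_segment ℝ x w
  refine ⟨α, ⟨hα.1, le_antisymm (Submodule.span_le.2 fun w hw => hw.2) fun u hu => ?_,
    fun w hw => neg_of_mem_interior_closure hw hα⟩, hαv⟩
  have hu : B α u = 0 := hu
  have hcont : Filter.Tendsto (fun t : ℝ => y + t • u) (nhdsWithin 0 (Set.Ioi 0)) (nhds y) := by
    have : Continuous fun t : ℝ => y + t • u := by fun_prop
    simpa using (this.tendsto 0).mono_left nhdsWithin_le_nhds
  have hev : ∀ᶠ w in nhds y, w ∈ U ∧ ∀ γ ∈ F.erase α, B γ w < 0 := by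
    refine (hUo.eventually_mem hyU).and ?_
    rw [Filter.eventually_all_finset]
    exact fun γ hγ => (continuous_form_left B γ).continuousAt.eventually_lt continuousAt_const
      (hyneg γ hγ)
  obtain ⟨t, ⟨htU, htneg⟩, ht0⟩ := ((hcont.eventually hev).and self_mem_nhdsWithin).exists
  have ht0 : t ≠ 0 := ne_of_gt ht0
  have hmem1 : y + t • u ∈ {w | w ∈ closure (openChamber B L W x) ∧ B α w = 0} :=
    have h0 : B α (y + t • u) = 0 := by simp [hyα, hu]
    ⟨hfacet _ htU h0 htneg, h0⟩
  have hmem2 : y ∈ {w | w ∈ closure (openChamber B L W x) ∧ B α w = 0} :=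
    ⟨hfacet y hyU hyα hyneg, hyα⟩
  have hu' : u = t⁻¹ • ((y + t • u) - y) := by
    rw [add_sub_cancel_left, smul_smul, inv_mul_cancel₀ ht0, one_smul]
  rw [hu']
  exact Submodule.smul_mem _ _
    (Submodule.sub_mem _ (Submodule.subset_span hmem1) (Submodule.subset_span hmem2))

/-! ### Pairs of simple roots -/

/-- Distinct simple roots have nonpositive inner product: otherwise the reflection of one in the
other would be an almost-root taking both signs on the chamber. -/
lemma inner_simpleRoots_nonpos (hsymm : B.IsSymm) (hL : IsEuclidean B ∨ IsLorentzian B)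
    [DiscreteTopology L] [IsZLattice ℝ L]
    (hWO : W ≤ orthogonalGroup B L) {x : V} (hx : x ∈ mirrorComplement B L W) {α β : V}
    (hα : α ∈ simpleRoots B L W (closure (openChamber B L W x)))
    (hβ : β ∈ simpleRoots B L W (closure (openChamber B L W x))) (hne : α ≠ β) :
    B α β ≤ 0 := by
  by_contra! hpos
  have hαx := simpleRoots_subset_negativeRoots hsymm hL hx.1 hα
  have hβx := simpleRoots_subset_negativeRoots hsymm hL hx.1 hβ
  have key : ∀ α β : V, α ∈ simpleRoots B L W (closure (openChamber B L W x)) →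
      α ∈ negativeRoots B L W x → β ∈ negativeRoots B L W x → α ≠ β →
      ∃ v ∈ closure (openChamber B L W x), B α v = 0 ∧ B β v < 0 := by
    intro α β hα hαx hβx hne
    by_contra! h
    have hker : LinearMap.ker (B α) ≤ LinearMap.ker (B β) := by
      rw [← hα.2.1, Submodule.span_le]
      rintro v ⟨hv, hv0⟩
      exact le_antisymm (nonpos_of_mem_closure hv hβx) (h v hv hv0)
    have hα0 := hαx.1.1.1.2.1
    -- Two forms with the same kernel are proportional, and so are the vectors representing them.
    have hprop : ∀ u, B β u = B α β / B α α * B α u := by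
      intro u
      have h1 : u - (B α u / B α α) • α ∈ LinearMap.ker (B β) := hker (by
        simp [hα0.ne'])
      simp only [LinearMap.mem_ker, map_sub, map_smul, smul_eq_mul, hsymm.eq β α] at h1
      field_simp at h1 ⊢
      linarith
    have hβα : β = (B α β / B α α) • α := by
      by_contra hne'
      have h2 := pos_of_orthogonal_mem_modelCone hsymm hL hx.1
        (a := β - (B α β / B α α) • α) (by
          rw [hsymm.eq]
          simp [hprop x]) (sub_ne_zero.2 hne')
      simp only [map_sub, map_smul, LinearMap.sub_apply, LinearMap.smul_apply, smul_eq_mul,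
        hprop] at h2
      linarith
    have hc : 0 < B α β / B α α := by
      have h3 := hprop x
      have h4 := hβx.2
      by_contra! hle
      rw [h3] at h4
      nlinarith [hαx.2]
    exact hne (eq_of_pos_smul_root hαx.1.1 hβx.1.1 hc hβα).symm
  obtain ⟨v, hv, hαv, hβv⟩ := key α β hα hαx hβx hne
  obtain ⟨w, hw, hβw, hαw⟩ := key β α hβ hβx hαx hne.symm
  have hγ := hαx.1.isAlmostRootOf.reflect hWO hβx.1.isAlmostRootOf
  have hα0 := hαx.1.1.1.2.1
  have hγw := (hγ.neg_of_neg hx hv (by simp [hαv, hβv])).2 w hw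
  simp only [map_sub, map_smul, LinearMap.sub_apply, LinearMap.smul_apply, smul_eq_mul, hβw,
    zero_sub] at hγw
  have : 0 < 2 / B α α * B α β := by positivity
  nlinarith

/-! ### The walls in front of the mirror of an almost-root -/

/-- The projection to `β^⊥` of a vector of the closed chamber on which `β` is negative lies in the
model cone. -/
lemma project_mem_futureCone (hsymm : B.IsSymm) (hL : IsEuclidean B ∨ IsLorentzian B) {x w β : V}
    (hx : x ∈ mirrorComplement B L W) (hw : w ∈ closure (openChamber B L W x))
    (hβ0 : 0 < B β β) (hβx : B β x < 0) (hβw : B β w < 0) :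
    w - (B β w / B β β) • β ∈ futureCone B x := by
  rcases hL with hE | hL
  · exact Or.inl hE
  have hww := self_nonpos_of_mem_closure hL hw
  have hxw := neg_of_mem_closure hsymm hL hx.1 hw (by rintro rfl; simp at hβw)
  refine Or.inr ⟨?_, ?_⟩
  · have h1 : B (w - (B β w / B β β) • β) (w - (B β w / B β β) • β) =
        B w w - (B β w) ^ 2 / B β β := by
      simp only [map_sub, map_smul, LinearMap.sub_apply, LinearMap.smul_apply, smul_eq_mul,
        hsymm.eq w β]
      field_simp
      ring
    have h2 : 0 < (B β w) ^ 2 / B β β := by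
      have := sq_pos_of_ne_zero hβw.ne
      positivity
    rw [h1]; linarith
  · have h1 : B β w / B β β < 0 := div_neg_of_neg_of_pos hβw hβ0
    simp only [map_sub, map_smul, smul_eq_mul, hsymm.eq x β]
    nlinarith [mul_pos_of_neg_of_neg h1 hβx]

/-- The projection of `k` to the mirror of `β` is not in the interior of the chamber, and a wall
separates `k` from it, in the weak sense. Since `k` may be a boundary point of the chamber, the wall
is found as a limit, points `k + t (x - k)` of the interior taking the place of `k`. Local
finiteness makes one wall serve for arbitrarily small `t`. -/
lemma exists_separating_simpleRoot (hsymm : B.IsSymm) (hL : IsEuclidean B ∨ IsLorentzian B)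
    [DiscreteTopology L] [IsZLattice ℝ L]
    {x k β : V} (hx : x ∈ mirrorComplement B L W) (hk : k ∈ closure (openChamber B L W x))
    (hβ : IsAlmostRootOf B L W β) (hβk : B β k < 0) :
    ∃ α ∈ simpleRoots B L W (closure (openChamber B L W x)), 0 < B α β ∧
      B α β * B β k ≤ B α k * B β β := by
  have hβ0 := hβ.1.2.1
  have hDc := convex_openChamber (L := L) (W := W) hsymm hL hx.1
  have hDo := isOpen_openChamber (L := L) (W := W) hsymm hL x
  have hxD := mem_openChamber_self (L := L) (W := W) hx.1
  have hβD := (hβ.neg_of_neg hx hk hβk).1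
  let ρ : ℝ → V := fun t => k + t • (x - k)
  let q : ℝ → V := fun t => ρ t - (B β (ρ t) / B β β) • β
  have hρD : ∀ t ∈ Set.Ioc (0 : ℝ) 1, ρ t ∈ openChamber B L W x := fun t ht =>
    hDo.interior_eq ▸ hDc.add_smul_sub_mem_interior' hk (hDo.interior_eq.symm ▸ hxD) ht
  have hρ0 : ρ 0 = k := by simp [ρ]
  have hρneg : ∀ t ∈ Set.Icc (0 : ℝ) 1,
      ρ t ∈ closure (openChamber B L W x) ∧ B β (ρ t) < 0 := by
    intro t ht
    rcases ht.1.eq_or_lt with rfl | h0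
    · rw [hρ0]; exact ⟨hk, hβk⟩
    · have := hρD t ⟨h0, ht.2⟩
      exact ⟨subset_closure this, hβD _ this⟩
  have hqcone : ∀ t ∈ Set.Icc (0 : ℝ) 1, q t ∈ futureCone B x := fun t ht =>
    project_mem_futureCone hsymm hL hx (hρneg t ht).1 hβ0 (hβD x hxD) (hρneg t ht).2
  have hρc : Continuous ρ := by fun_prop
  have hqc : Continuous q :=
    hρc.sub ((((continuous_form_left B β).comp hρc).div_const _).smul continuous_const)
  let Q : Set V := (fun p : ℝ × ℝ => x + p.2 • (q p.1 - x)) '' (Set.Icc 0 1 ×ˢ Set.Icc 0 1)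
  have hQc : IsCompact Q := (isCompact_Icc.prod isCompact_Icc).image (by fun_prop)
  have hQcone : Q ⊆ futureCone B x := by
    rintro _ ⟨⟨t, s⟩, ⟨ht, hs⟩, rfl⟩
    exact (convex_futureCone hsymm hL hx.1).add_smul_sub_mem (mem_futureCone_self hx.1)
      (hqcone t ht) hs
  have hfin : {α | α ∈ simpleRoots B L W (closure (openChamber B L W x)) ∧
      ∃ y ∈ Q, B α y = 0}.Finite :=
    (finite_almostRoots_meeting_compact (L := L) hsymm hL hQc
      (hQcone.trans (futureCone_subset_modelCone x))).subset fun α hα => ⟨hα.1.1.1.1, hα.2⟩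
  have hwall : ∀ t ∈ Set.Ioc (0 : ℝ) 1,
      ∃ α ∈ simpleRoots B L W (closure (openChamber B L W x)),
        (∃ y ∈ Q, B α y = 0) ∧ 0 < B α β ∧ 0 ≤ B α (q t) := by
    intro t ht
    have ht' : t ∈ Set.Icc (0 : ℝ) 1 := ⟨ht.1.le, ht.2⟩
    have hqD : q t ∉ openChamber B L W x := fun h => by
      have := hβD _ h
      simp [q, hβ0.ne'] at this
    obtain ⟨α, hα, hαq⟩ := exists_simpleRoot_nonneg hsymm hL hx.1 (hqcone t ht') hqD
    have hαx := simpleRoots_subset_negativeRoots hsymm hL hx.1 hα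
    refine ⟨α, hα, ?_, ?_, hαq⟩
    · obtain ⟨y, hy, hy0⟩ := (convex_segment x (q t)).isPreconnected.intermediate_value
        (left_mem_segment ℝ x _) (right_mem_segment ℝ x _)
        (continuous_form_left B α).continuousOn ⟨hαx.2.le, hαq⟩
      rw [segment_eq_image'] at hy
      obtain ⟨s, hs, rfl⟩ := hy
      exact ⟨_, ⟨(t, s), ⟨ht', hs⟩, rfl⟩, hy0⟩
    · have h1 : B α (ρ t) < 0 := (hρD t ht).2 α hαx
      have h2 : B β (ρ t) / B β β < 0 := div_neg_of_neg_of_pos (hρneg t ht').2 hβ0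
      simp only [q, map_sub, map_smul, smul_eq_mul] at hαq
      by_contra! h3
      nlinarith [mul_nonneg_of_nonpos_of_nonpos h2.le h3]
  obtain ⟨α, hα, hαβ, hα0⟩ :
      ∃ α ∈ simpleRoots B L W (closure (openChamber B L W x)), 0 < B α β ∧ 0 ≤ B α (q 0) := by
    by_contra! hno
    have hev : ∀ᶠ t in nhdsWithin (0 : ℝ) (Set.Ioi 0),
        ∀ α ∈ {α | α ∈ simpleRoots B L W (closure (openChamber B L W x)) ∧ ∃ y ∈ Q, B α y = 0},
          0 < B α β → B α (q t) < 0 := by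
      rw [Filter.eventually_all_finite hfin]
      rintro α ⟨hα, -⟩
      by_cases hαβ : 0 < B α β
      · have hc : Continuous fun t => B α (q t) := (continuous_form_left B α).comp hqc
        have := hc.continuousAt.eventually_lt continuousAt_const (hno α hα hαβ)
        exact (this.filter_mono nhdsWithin_le_nhds).mono fun t ht _ => ht
      · exact Filter.Eventually.of_forall fun t h => absurd h hαβ
    obtain ⟨t, ht, ht1⟩ := (hev.and (Ioc_mem_nhdsGT one_pos)).exists
    obtain ⟨α, hα, hy, hαβ, hαq⟩ := hwall t ht1
    exact (ht α ⟨hα, hy⟩ hαβ).not_ge hαq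
  refine ⟨α, hα, hαβ, ?_⟩
  simp only [q, hρ0, map_sub, map_smul, smul_eq_mul, sub_nonneg] at hα0
  rw [div_mul_eq_mul_div, div_le_iff₀ hβ0] at hα0
  linarith

/-! ### Comparison of priorities -/

/-- If a simple root `α` is negative at `k` and nonnegative at the projection of `k` to `β^⊥`, where
`β` is an almost-root that is also negative at `k`, then `α` has smaller priority than `β`, unless
it lies on the ray of `β`.

When the mirrors meet this is immediate from `α · β < |α| |β|`. Otherwise the difference `g` of the
normalized vectors is nonspacelike (and nonzero). It is negative on a vector `v` of the facet of
`α`, so it points to the future, and `g · k ≤ 0`. Equality would force `k` to be lightlike and the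
mirrors to be parallel at `k`; then the negative of the reflection of `β` in `α` would be an
almost-root that is negative at `k` but positive at `v`. -/
lemma priority_lt_or_eq_smul (hsymm : B.IsSymm) (hL : IsEuclidean B ∨ IsLorentzian B)
    (hWO : W ≤ orthogonalGroup B L) {x k α β : V} (hx : x ∈ mirrorComplement B L W)
    (hk : k ∈ closure (openChamber B L W x))
    (hα : α ∈ simpleRoots B L W (closure (openChamber B L W x))) (hαk : B α k < 0)
    (hβ : IsAlmostRootOf B L W β) (hβk : B β k < 0)
    (hsep : B α β * B β k ≤ B α k * B β β) :
    priority B k α < priority B k β ∨ ∃ c : ℝ, 0 < c ∧ β = c • α := by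
  have hβ0 := hβ.1.2.1
  have hα0 := hα.1.1.1.2.1
  rw [priority_lt_iff hsymm hα0 hβ0]
  obtain ⟨a, ha, haa⟩ : ∃ a : ℝ, 0 < a ∧ B α α = a ^ 2 :=
    ⟨√(B α α), Real.sqrt_pos.2 hα0, (Real.sq_sqrt hα0.le).symm⟩
  obtain ⟨b, hb, hbb⟩ : ∃ b : ℝ, 0 < b ∧ B β β = b ^ 2 :=
    ⟨√(B β β), Real.sqrt_pos.2 hβ0, (Real.sq_sqrt hβ0.le).symm⟩
  rw [haa, hbb, Real.sqrt_sq ha.le, Real.sqrt_sq hb.le]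
  by_cases hlt : B α β < a * b
  · left
    rw [hbb] at hsep
    have h1 : b * (a * B β k) < b * (b * B α k) := by
      nlinarith [mul_pos (sub_pos.2 hlt) (neg_pos.2 hβk)]
    exact lt_of_mul_lt_mul_left h1 hb.le
  push Not at hlt
  have hgapp : ∀ u, B (a • β - b • α) u = a * B β u - b * B α u := fun u => by simp
  have hgg : B (a • β - b • α) (a • β - b • α) = 2 * (a * b) * (a * b - B α β) := by
    simp only [map_sub, map_smul, LinearMap.sub_apply, LinearMap.smul_apply, smul_eq_mul, haa, hbb,
      hsymm.eq β α]
    ring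
  generalize hg : a • β - b • α = g at hgapp hgg
  by_cases hg0 : g = 0
  · right
    refine ⟨b / a, by positivity, ?_⟩
    rw [hg0, sub_eq_zero] at hg
    rw [div_eq_inv_mul, mul_smul, ← hg, smul_smul, inv_mul_cancel₀ ha.ne', one_smul]
  left
  have hgg0 : B g g ≤ 0 := by
    rw [hgg]
    exact mul_nonpos_of_nonneg_of_nonpos (by positivity) (by linarith)
  rcases hL with hE | hL
  · exact absurd hgg0 (hE g hg0).not_ge
  have hxx := mem_modelCone_of_lorentzian hL hx.1
  have hxg := inner_ne_zero_of_nonspacelike hsymm hL hxx hgg0 hg0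
  -- A nonzero nonspacelike vector is not proportional to `α`, so it does not vanish on the facet.
  obtain ⟨v, hv, hαv, hgv⟩ :
      ∃ v ∈ closure (openChamber B L W x), B α v = 0 ∧ B g v ≠ 0 := by
    by_contra! h
    have hker : LinearMap.ker (B α) ≤ LinearMap.ker (B g) := by
      rw [← hα.2.1, Submodule.span_le]
      rintro v ⟨hv, hv0⟩
      exact h v hv hv0
    have hprop : ∀ u, B g u = B α u / B α α * B g α := by
      intro u
      have h1 : u - (B α u / B α α) • α ∈ LinearMap.ker (B g) := hker (by simp [hα0.ne'])
      simp only [LinearMap.mem_ker, map_sub, map_smul, smul_eq_mul] at h1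
      linarith
    have hgα : B g α = 0 := by
      have h1 := hprop g
      rw [hsymm.eq α g] at h1
      by_contra hne
      have h2 : 0 < B g α / B α α * B g α := by
        rw [div_mul_eq_mul_div]
        exact div_pos (mul_self_pos.2 hne) hα0
      linarith
    apply hxg
    rw [hsymm.eq, hprop x, hgα, mul_zero]
  have hβneg := hβ.neg_of_neg hx hk hβk
  have hgv : B g v < 0 := by
    refine lt_of_le_of_ne ?_ hgv
    rw [hgapp, hαv]
    nlinarith [hβneg.2 v hv]
  have hvv := self_nonpos_of_mem_closure hL hv
  have hxv := neg_of_mem_closure hsymm hL hx.1 hv (by rintro rfl; simp at hgv)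
  have hkk := self_nonpos_of_mem_closure hL hk
  have hxk := neg_of_mem_closure hsymm hL hx.1 hk (by rintro rfl; simp at hβk)
  have hxg : B x g < 0 := by
    by_contra! h
    have h1 := inner_nonpos_of_nonspacelike hsymm hL (y := -g) hxx (by simpa using hgg0) hvv
      (by simpa using lt_of_le_of_ne h hxg.symm) hxv
    simp only [map_neg, LinearMap.neg_apply] at h1
    linarith
  have hgk := inner_nonpos_of_nonspacelike hsymm hL hxx hgg0 hkk hxg hxk
  rcases hgk.lt_or_eq with hgk | hgk
  · rw [hgapp] at hgk
    linarith
  exfalso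
  obtain ⟨c, hc⟩ := proportional_of_nonspacelike hsymm hL hxx hgg0 hkk hxk hgk
  have hgg' : B g g = 0 := by
    nth_rw 2 [hc]
    rw [map_smul, hgk, smul_zero]
  have hαβ : B α β = a * b := by
    rw [hgg] at hgg'
    rcases mul_eq_zero.1 hgg' with h | h
    · have : 0 < 2 * (a * b) := by positivity
      linarith
    · linarith
  have hδ := hα.1.isAlmostRootOf.reflect hWO hβ
  have hδapp : ∀ u, a * B (β - (2 / B α α * B α β) • α) u = B g u - b * B α u := by
    intro u
    rw [hgapp, hαβ, haa]
    simp only [map_sub, map_smul, LinearMap.sub_apply, LinearMap.smul_apply, smul_eq_mul]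
    field_simp
    ring
  generalize β - (2 / B α α * B α β) • α = δ at hδ hδapp
  have h1 := hδapp k
  have h2 := hδapp v
  rw [hgk] at h1
  rw [hαv] at h2
  have hδk : 0 < B δ k := by
    by_contra! h
    nlinarith [mul_pos hb (neg_pos.2 hαk), mul_nonneg ha.le (neg_nonneg.2 h)]
  have hδv := (hδ.neg.neg_of_neg hx hk (by simpa using hδk)).2 v hv
  simp only [map_neg, LinearMap.neg_apply] at hδv
  nlinarith

/-- An almost-root negative at `k` that is not simple and has nonpositive inner products with the
simple roots orthogonal to `k` makes a positive inner product with some other simple root that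
precedes it, in the order by priority and then by norm. -/
lemma exists_preceding_simpleRoot (hsymm : B.IsSymm) (hL : IsEuclidean B ∨ IsLorentzian B)
    [DiscreteTopology L] [IsZLattice ℝ L]
    (hWO : W ≤ orthogonalGroup B L) {x k β : V} (hx : x ∈ mirrorComplement B L W)
    (hk : k ∈ closure (openChamber B L W x)) (hβ : IsAlmostRootOf B L W β) (hβk : B β k < 0)
    (hβ₀ : ∀ α ∈ batchZero B L W (closure (openChamber B L W x)) k, B β α ≤ 0)
    (hβs : β ∉ simpleRoots B L W (closure (openChamber B L W x))) :
    ∃ α ∈ simpleRoots B L W (closure (openChamber B L W x)) \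
        batchZero B L W (closure (openChamber B L W x)) k, 0 < B β α ∧
      (priority B k α < priority B k β ∨
        priority B k α = priority B k β ∧ B α α < B β β) := by
  obtain ⟨α, hα, hαβ, hsep⟩ := exists_separating_simpleRoot hsymm hL hx hk hβ hβk
  rw [hsymm.eq] at hαβ
  have hα₀ : α ∉ batchZero B L W (closure (openChamber B L W x)) k := fun h =>
    (hβ₀ α h).not_gt hαβ
  refine ⟨α, ⟨hα, hα₀⟩, hαβ, ?_⟩
  have hαk : B α k < 0 :=
    lt_of_le_of_ne (nonpos_of_mem_closure hk (simpleRoots_subset_negativeRoots hsymm hL hx.1 hα))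
      fun h => hα₀ ⟨hα, h⟩
  rcases priority_lt_or_eq_smul hsymm hL hWO hx hk hα hαk hβ hβk hsep with h | ⟨c, hc, h⟩
  · exact Or.inl h
  · refine Or.inr ⟨by rw [h, priority_smul hc], ?_⟩
    refine (eq_or_lt_of_pos_smul_root hα.1.1 hβ.1 hc h).resolve_left ?_
    rintro rfl
    exact hβs hα

end ReflLattice

theorem mainTheorem4
    {V : Type*} [NormedAddCommGroup V] [NormedSpace ℝ V] [FiniteDimensional ℝ V]
    (B : LinearMap.BilinForm ℝ V) (hsymm : B.IsSymm)
    (L : Submodule ℤ V) [DiscreteTopology L] [IsZLattice ℝ L] (hrat : IsRationalOn B L)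
    (hL : IsEuclidean B ∨ IsLorentzian B)
    (W : Subgroup (V ≃ₗ[ℝ] V)) (hWO : W ≤ ReflLattice.orthogonalGroup B L)
    (hW : IsGeneratedByReflections B L W)
    (k : V) (hk0 : k ≠ 0)
    -- in the Lorentzian case the control vector is timelike or lightlike
    (hk : IsLorentzian B → B k k ≤ 0)
    (C : Set V) (hC : IsChamber B L W C) (hkC : k ∈ C)
    -- the sequence `β 0, β 1, …` has `N` terms, where `N` is finite or infinite
    (N : ℕ∞) (β : ℕ → V)
    (hβ : ∀ i : ℕ, (i : ℕ∞) < N → IsAlmostRootOf B L W (β i))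
    (hβk : ∀ i : ℕ, (i : ℕ∞) < N → B (β i) k < 0)
    (h_nonpos : ∀ i : ℕ, (i : ℕ∞) < N → ∀ α ∈ batchZero B L W C k, B (β i) α ≤ 0)
    (h_all : ∀ α ∈ simpleRoots B L W C, α ∉ batchZero B L W C k →
      ∃ i : ℕ, (i : ℕ∞) < N ∧ β i = α)
    (h_priority : ∀ i j : ℕ, i < j → (j : ℕ∞) < N →
      priority B k (β i) ≤ priority B k (β j))
    (h_norm : ∀ i j : ℕ, i < j → (j : ℕ∞) < N →
      priority B k (β i) = priority B k (β j) → B (β i) (β i) ≤ B (β j) (β j)) :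
    {α : V | ∃ i : ℕ, (i : ℕ∞) < N ∧ Approved B β i ∧ β i = α} =
      simpleRoots B L W C \ batchZero B L W C k := by
  classical
  obtain ⟨x, hx, rfl⟩ := hC
  rw [connectedComponentIn_mirrorComplement hsymm hL hx] at *
  set C := closure (openChamber B L W x)
  have hfirst : ∀ α ∈ simpleRoots B L W C, α ∉ batchZero B L W C k →
      ∃ i : ℕ, (i : ℕ∞) < N ∧ β i = α ∧ ∀ j < i, β j ≠ α := by
    intro α hα hα₀
    have h := h_all α hα hα₀
    refine ⟨Nat.find h, (Nat.find_spec h).1, (Nat.find_spec h).2, fun j hj hjα => ?_⟩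
    exact Nat.find_min h hj ⟨lt_trans (by exact_mod_cast hj) (Nat.find_spec h).1, hjα⟩
  -- A term is approved exactly if it is the first occurrence of a simple root.
  have main : ∀ i : ℕ, (i : ℕ∞) < N →
      (Approved B β i → β i ∈ simpleRoots B L W C) ∧
      (β i ∈ simpleRoots B L W C → (∀ j < i, β j ≠ β i) → Approved B β i) := by
    intro i
    induction i using Nat.strong_induction_on with
    | _ i ih =>
    intro hi
    have hlt : ∀ j < i, (j : ℕ∞) < N := fun j hj => lt_trans (by exact_mod_cast hj) hi
    constructor
    · intro happ
      by_contra hs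
      obtain ⟨α, ⟨hα, hα₀⟩, hpos, hprec⟩ := exists_preceding_simpleRoot hsymm hL hWO hx hkC
        (hβ i hi) (hβk i hi) (h_nonpos i hi) hs
      obtain ⟨j, hj, rfl, hjfirst⟩ := hfirst α hα hα₀
      have hji : j < i := by
        by_contra! hij
        rcases hij.eq_or_lt with rfl | hij
        · exact hs hα
        · rcases hprec with h | ⟨h, h'⟩
          · exact (h_priority i j hij hj).not_gt h
          · exact (h_norm i j hij hj h.symm).not_gt h'
      rw [Approved] at happ
      exact (happ j hji ((ih j hji hj).2 hα hjfirst)).not_gt hpos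
    · intro hs hne
      rw [Approved]
      exact fun j hji hj => inner_simpleRoots_nonpos hsymm hL hWO hx hs
        ((ih j hji (hlt j hji)).1 hj) (hne j hji).symm
  ext α
  constructor
  · rintro ⟨i, hi, happ, rfl⟩
    exact ⟨(main i hi).1 happ, fun h => (hβk i hi).ne h.2⟩
  · rintro ⟨hα, hα₀⟩
    obtain ⟨i, hi, rfl, hne⟩ := hfirst α hα hα₀
    exact ⟨i, hi, (main i hi).2 hα hne, rfl⟩
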